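/- Setting. A relation $R$ with finitely many tuples is joined with a relation $S$. Each tuple $i$ of $R$ has a success probability $p_i$, and the $p_i$ are independent and uniformly distributed on $[a,b]$, where $0\le a\le b\le 1$ (for $a=b$ this means $p_i=a$). A super-round consists of a fixed number $m$ of rounds, $1\le m\le |S|$. In each round a learning strategy for $R$-scan chooses a tuple $i$ of $R$, which is joined with the next tuple of $S$; given the success probabilities and the past, the join produces a result (success) with probability $p_i$ and otherwise fails. The strategy may be randomized; its choice in each round depends only on the tuples chosen and the outcomes observed earlier in the super-round, the super-round being considered on its own, without outcomes observed in previous super-rounds. In particular, every strategy that scans and explores the tuples of $R$ sequentially, with possible returns to tuples already explored, is of this kind. The failure proportion of the super-round is the fraction of its rounds in which the join produces no result. Proposition. The expected failure proportion in a super-round has the asymptotic lower bound $(1-b)+(b-a)\sqrt{2/|S|}$ as $|S|\to\infty$, for every strategy. Precisely: for every $\varepsilon>0$ there is an $n_0$, depending only on $\varepsilon$, such that whenever $|S|\ge n_0$, for all $0\le a\le b\le 1$, every relation $R$, every strategy as above and every $1\le m\le |S|$, $$\mathbb{E}[\text{failure proportion}]\ \ge\ (1-b)+(1-\varepsilon)\,(b-a)\sqrt{\frac{2}{|S|}}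 .$$ -/

import Mathlib

open MeasureTheory

/-- The uniform law on `[a, b]`, as the law of `a + (b - a) U` with `U` uniform on `[0, 1]`.
For `a = b` it is the point mass at `a`. -/
noncomputable def uniformLaw (a b : ℝ) : Measure ℝ :=
  (volume.restrict (Set.Icc (0 : ℝ) 1)).map (fun t => a + (b - a) * t)

/-- What has been observed in a super-round so far, most recent round first: for each round,
the tuple of `R` that was joined, and whether the join produced a result (`true` = success). -/
abbrev History (R : Type*) := List (R × Bool)

/-- A (possibly randomized) learning strategy of `R`-scan for a super-round: given the observations
made so far, the law of the tuple of `R` that is joined next. The strategy sees outcomes only,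
not the success probabilities. Any tuple, new or already explored, may be chosen; a sequential
scan of `R` with returns to explored tuples is a particular case. -/
abbrev Strategy (R : Type*) := History R → PMF R

/-- The probability of the history `h` under the strategy `σ` when tuple `i` of `R` has success
probability `p i`: in each round the tuple is drawn by the strategy, and the join with the next
tuple of `S` then succeeds with probability `p i`, independently of the past. -/
noncomputable def historyProb {R : Type*} (σ : Strategy R) (p : R → ℝ) : History R → ℝ
  | [] => 1
  | x :: h => historyProb σ p h * (σ h x.1).toReal * (if x.2 then p x.1 else 1 - p x.1)

/-- The fraction of the rounds in which the join produced no result. -/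
noncomputable def failureProportion {R : Type*} (h : History R) : ℝ :=
  ((h.map Prod.snd).count false : ℝ) / (h.length : ℝ)

/-- Expected failure proportion of a super-round of `m` rounds, for given success probabilities. -/
noncomputable def expectedFailureProportionGiven {R : Type*} [Fintype R]
    (σ : Strategy R) (m : ℕ) (p : R → ℝ) : ℝ :=
  ∑ h : Fin m → R × Bool, historyProb σ p (List.ofFn h) * failureProportion (List.ofFn h)

/-- Expected failure proportion of a super-round of `m` rounds, when the success probabilities of
the tuples of `R` are independent and uniform on `[a, b]`. -/
noncomputable def expectedFailureProportion {R : Type*} [Fintype R]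
    (σ : Strategy R) (m : ℕ) (a b : ℝ) : ℝ :=
  ∫ p : R → ℝ, expectedFailureProportionGiven σ m p ∂(Measure.pi fun _ : R => uniformLaw a b)

/-!
Write the success probability of tuple `i` as `a + (b - a) * t i` with `t i` uniform on `[0, 1]`;
its failure probability is `(1 - b) + (b - a) * (1 - t i)`. The bound comes from a Lagrangian
relaxation. Fix a charge `lam` and subtract it from the normalized failure rate `1 - t i` in every
round. The expected number of failures in `m` rounds becomes `m * ((1 - b) + (b - a) * lam)` plus
`b - a` times a sum over the tuples, the term of tuple `i` being the expected sum of `1 - t i - lam`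
over the rounds that join `i` (`iterate_stepExpectation_count`). It suffices that each of these
terms is nonnegative for `lam = (1 - ε) * √(2 / |S|)`.

With the other success probabilities fixed, the term of tuple `i` is the cost of a one-armed
stopping problem with at most `m ≤ |S|` joins. Two relaxations give it a simple form. First, a join
with success probability `a + (b - a) * x` is a noisy observation of one with success probability
`x`, so the player may be shown the latter. Second, after the first noiseless failure the player
may be told `x`, after which the gain is at most `|S| * (lam - (1 - x))⁺`. What remains is to choose
the number `s` of initial successes after which a tuple is abandoned, with cost `stoppingCost`; this
is `neg_stoppingCost_le_integral`, proved by backward induction on the number of rounds left.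

Finally, `stoppingCost` is nonnegative: it is at least `s / (s + 1)`, the probability of a failure
within `s` joins, minus `lam` times the harmonic number of `s`, which is negligible, and minus a
gain of at most `|S| * lam ^ 2 / 2 = (1 - ε) ^ 2 < 1`, which is itself negligible while `s` stays
bounded (`exists_forall_stoppingCost_nonneg`).
-/

/-! ### Expectations over histories -/

/-- The expectation of `g` after one further round, from the history `h` on, when tuple `i` has
success probability `p i`. -/
noncomputable def stepExpectation {R : Type*} [Fintype R] (σ : Strategy R) (p : R → ℝ)
    (g : History R → ℝ) (h : History R) : ℝ :=
  ∑ x : R × Bool, (σ h x.1).toReal * (if x.2 then p x.1 else 1 - p x.1) * g (x :: h)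

theorem PMF.sum_toReal_eq_one {R : Type*} [Fintype R] (P : PMF R) :
    ∑ j, (P j).toReal = 1 := by
  have h := P.tsum_coe
  rw [tsum_fintype] at h
  rw [← ENNReal.toReal_sum (fun j _ => P.apply_ne_top j), h, ENNReal.toReal_one]

theorem stepExpectation_eq_sum {R : Type*} [Fintype R] (σ : Strategy R) (p : R → ℝ)
    (g : History R → ℝ) (h : History R) :
    stepExpectation σ p g h =
      ∑ j, (σ h j).toReal * (p j * g ((j, true) :: h) + (1 - p j) * g ((j, false) :: h)) := by
  simp only [stepExpectation, Fintype.sum_prod_type, Fintype.sum_bool]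
  refine Finset.sum_congr rfl fun j _ => ?_
  simp
  ring

/-- Summing against `historyProb` over the histories of length `m` is the same as iterating the
one-round expectation `m` times. -/
theorem sum_historyProb_mul_eq_iterate {R : Type*} [Fintype R] (σ : Strategy R) (p : R → ℝ)
    (m : ℕ) (g : History R → ℝ) :
    ∑ h : Fin m → R × Bool, historyProb σ p (List.ofFn h) * g (List.ofFn h) =
      (stepExpectation σ p)^[m] g [] := by
  induction m generalizing g with
  | zero => simp [historyProb]
  | succ m ih =>
    rw [Function.iterate_succ_apply, ← ih,
      ← (Fin.consEquiv fun _ : Fin (m + 1) => R × Bool).sum_comp, Fintype.sum_prod_type,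
      Finset.sum_comm]
    refine Finset.sum_congr rfl fun h _ => ?_
    simp only [stepExpectation, Finset.mul_sum]
    refine Finset.sum_congr rfl fun x _ => ?_
    simp [Fin.consEquiv, List.ofFn_succ, historyProb]
    ring_nf

/-! ### Decoupling the tuples -/

/-- The expected value, over the `r` rounds that follow the history `h`, of the number of rounds
that join tuple `i`, each counted with weight `1 - t i - lam`. Here tuple `j` has success
probability `a + (b - a) * t j`, so that `1 - t i` is its normalized failure rate, and `lam` is a
charge (a Lagrange multiplier) subtracted in every round. -/
noncomputable def tupleExcess {R : Type*} [Fintype R] [DecidableEq R] (σ : Strategy R)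
    (a b lam : ℝ) (i : R) : ℕ → History R → (R → ℝ) → ℝ
  | 0, _, _ => 0
  | r + 1, h, t => ∑ j, (σ h j).toReal *
      ((if j = i then 1 - t i - lam else 0)
        + (a + (b - a) * t j) * tupleExcess σ a b lam i r ((j, true) :: h) t
        + (1 - (a + (b - a) * t j)) * tupleExcess σ a b lam i r ((j, false) :: h) t)

@[fun_prop]
theorem continuous_tupleExcess {R : Type*} [Fintype R] [DecidableEq R] (σ : Strategy R)
    (a b lam : ℝ) (i : R) (r : ℕ) (h : History R) :
    Continuous (tupleExcess σ a b lam i r h) := by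
  induction r generalizing h with
  | zero => exact continuous_const
  | succ r ih =>
    change Continuous fun t => tupleExcess σ a b lam i (r + 1) h t
    simp only [tupleExcess]
    refine continuous_finsetSum _ fun j _ => ?_
    have h1 := ih ((j, true) :: h)
    have h2 := ih ((j, false) :: h)
    split_ifs <;> fun_prop

/-- The number of failures is the sum of the per-tuple contributions: the multiplier decouples
the tuples of `R`. -/
theorem iterate_stepExpectation_count {R : Type*} [Fintype R] [DecidableEq R] (σ : Strategy R)
    (a b lam : ℝ) (t : R → ℝ) (r : ℕ) (h : History R) :
    (stepExpectation σ (fun j => a + (b - a) * t j))^[r]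
        (fun h => ((h.map Prod.snd).count false : ℝ)) h =
      ((h.map Prod.snd).count false : ℝ) + r * ((1 - b) + (b - a) * lam)
        + (b - a) * ∑ i, tupleExcess σ a b lam i r h t := by
  induction r generalizing h with
  | zero => simp [tupleExcess]
  | succ r ih =>
    rw [Function.iterate_succ_apply', stepExpectation_eq_sum]
    have hsum : ∑ i, tupleExcess σ a b lam i (r + 1) h t =
        ∑ j, (σ h j).toReal * ((1 - t j - lam)
          + (a + (b - a) * t j) * ∑ i, tupleExcess σ a b lam i r ((j, true) :: h) t
          + (1 - (a + (b - a) * t j)) * ∑ i, tupleExcess σ a b lam i r ((j, false) :: h) t) := by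
      simp only [tupleExcess]
      rw [Finset.sum_comm]
      refine Finset.sum_congr rfl fun j _ => ?_
      rw [← Finset.mul_sum, Finset.sum_add_distrib, Finset.sum_add_distrib, Finset.mul_sum,
        Finset.mul_sum]
      simp
    rw [hsum]
    simp only [ih, List.map_cons, List.count_cons_self]
    have hone := (σ h).sum_toReal_eq_one
    set C : ℝ := ((h.map Prod.snd).count false : ℝ) with hC
    have hsplit : C + ((r + 1 : ℕ) : ℝ) * ((1 - b) + (b - a) * lam) =
        ∑ j, (σ h j).toReal * (C + ((r + 1 : ℕ) : ℝ) * ((1 - b) + (b - a) * lam)) := by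
      rw [← Finset.sum_mul, hone, one_mul]
    rw [hsplit, Finset.mul_sum, ← Finset.sum_add_distrib]
    refine Finset.sum_congr rfl fun j _ => ?_
    simp
    ring

/-- Knowing every success probability, one can at best collect `(lam - (1 - t i))⁺` per round. -/
theorem neg_mul_max_le_tupleExcess {R : Type*} [Fintype R] [DecidableEq R] (σ : Strategy R)
    {a b lam : ℝ} (ha : 0 ≤ a) (hab : a ≤ b) (hb : b ≤ 1) (i : R) {t : R → ℝ}
    (ht : ∀ j, t j ∈ Set.Icc (0 : ℝ) 1) (r : ℕ) (h : History R) :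
    -(r * max 0 (lam - 1 + t i)) ≤ tupleExcess σ a b lam i r h t := by
  induction r generalizing h with
  | zero => simp [tupleExcess]
  | succ r ih =>
    unfold tupleExcess
    set M := max 0 (lam - 1 + t i)
    have hM0 : 0 ≤ M := le_max_left _ _
    have hM1 : lam - 1 + t i ≤ M := le_max_right _ _
    have hone : -(((r + 1 : ℕ) : ℝ) * M) =
        ∑ j, (σ h j).toReal * (-(((r + 1 : ℕ) : ℝ) * M)) := by
      rw [← Finset.sum_mul, (σ h).sum_toReal_eq_one, one_mul]
    rw [hone]
    refine Finset.sum_le_sum fun j _ => mul_le_mul_of_nonneg_left ?_ ENNReal.toReal_nonneg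
    obtain ⟨h0, h1⟩ := ht j
    have hp0 : 0 ≤ a + (b - a) * t j := add_nonneg ha (mul_nonneg (by linarith) h0)
    have hp1 : 0 ≤ 1 - (a + (b - a) * t j) := by nlinarith
    have e1 := mul_le_mul_of_nonneg_left (ih ((j, true) :: h)) hp0
    have e2 := mul_le_mul_of_nonneg_left (ih ((j, false) :: h)) hp1
    have e3 : -M ≤ (if j = i then 1 - t i - lam else 0) := by split_ifs <;> linarith
    push_cast
    linarith

/-! ### The optimal stopping problem of a single tuple -/

/-- The expected cost of the following play of a single tuple whose success probability `x` is
uniform on `[0, 1]`: join it until its first failure, but at most `s` times, at a cost of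
`1 - x - lam` per join; at the first failure learn `x`, and then gain `(lam - (1 - x))⁺` in each of
`n` rounds. The factor `x ^ k` is the probability that the first `k` joins succeed. -/
noncomputable def stoppingCost (n : ℕ) (lam : ℝ) (s : ℕ) : ℝ :=
  ∑ k ∈ Finset.range s,
    ∫ x in (0 : ℝ)..1, x ^ k * ((1 - x - lam) - n * ((1 - x) * max 0 (lam - 1 + x)))

/-- A lower bound for the contribution of a single tuple, the other success probabilities being
fixed. The rounds that join other tuples carry no information about it, so that its play amounts to
a randomized stopping rule, and by `hA` none of these can end below cost `0`. The weight
`x ^ s` is the likelihood of `s` successes and no failure so far. A join whose success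
probability is `a + (b - a) * x` is a noisy observation of one with success probability `x`,
because `a + (b - a) * x = b * x + a * (1 - x)`; by linearity in the weight, the
two outcomes of the noiseless join can be treated separately. -/
theorem neg_stoppingCost_le_integral {R : Type*} [Fintype R] [DecidableEq R] (σ : Strategy R)
    {a b lam : ℝ} (ha : 0 ≤ a) (hab : a ≤ b) (hb : b ≤ 1) (i : R) {t : R → ℝ}
    (ht : ∀ j, t j ∈ Set.Icc (0 : ℝ) 1) {n : ℕ} (hA : ∀ s ≤ n, 0 ≤ stoppingCost n lam s)
    (r : ℕ) (h : History R) (s : ℕ) (hs : s + r ≤ n) :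
    -stoppingCost n lam s ≤
      ∫ x in (0 : ℝ)..1, x ^ s * tupleExcess σ a b lam i r h (Function.update t i x) := by
  induction r generalizing h s with
  | zero => simpa [tupleExcess] using hA s (by omega)
  | succ r ih =>
    have hcont : ∀ h' : History R,
        Continuous fun x : ℝ => tupleExcess σ a b lam i r h' (Function.update t i x) :=
      fun h' => (continuous_tupleExcess σ a b lam i r h').comp
        (continuous_const.update i continuous_id)
    set W : History R → ℝ → ℝ :=
      fun h' x => tupleExcess σ a b lam i r h' (Function.update t i x) with hW
    have hcW : ∀ h', Continuous (W h') := hcont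
    have hexp : ∀ x : ℝ, x ^ s * tupleExcess σ a b lam i (r + 1) h (Function.update t i x) =
        ∑ j, (σ h j).toReal * (x ^ s * ((if j = i then 1 - x - lam else 0)
          + (a + (b - a) * Function.update t i x j) * W ((j, true) :: h) x
          + (1 - (a + (b - a) * Function.update t i x j)) * W ((j, false) :: h) x)) := by
      intro x
      simp only [tupleExcess, Finset.mul_sum, hW, Function.update_self]
      exact Finset.sum_congr rfl fun j _ => by ring
    have hcu : ∀ j, Continuous fun x : ℝ => Function.update t i x j := fun j =>
      (continuous_apply j).comp
        ((continuous_const (y := t)).update i (continuous_id (X := ℝ)))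
    simp only [hexp]
    rw [intervalIntegral.integral_finsetSum]
    swap
    · intro j _
      have h1 := hcW ((j, true) :: h)
      have h2 := hcW ((j, false) :: h)
      have h3 := hcu j
      apply Continuous.intervalIntegrable
      split_ifs <;> fun_prop
    have hone : -stoppingCost n lam s =
        ∑ j, (σ h j).toReal * (-stoppingCost n lam s) := by
      rw [← Finset.sum_mul, (σ h).sum_toReal_eq_one, one_mul]
    rw [hone]
    refine Finset.sum_le_sum fun j _ => ?_
    rw [intervalIntegral.integral_const_mul]
    refine mul_le_mul_of_nonneg_left ?_ ENNReal.toReal_nonneg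
    have c1 := hcW ((j, true) :: h)
    have c2 := hcW ((j, false) :: h)
    by_cases hj : j = i
    · subst hj
      simp only [if_true, Function.update_self]
      -- After a failure of the noiseless join, the trivial bound is used.
      have hfail : ∀ y, -(n * ∫ x in (0 : ℝ)..1, x ^ s * ((1 - x) * max 0 (lam - 1 + x))) ≤
          ∫ x in (0 : ℝ)..1, x ^ s * ((1 - x) * W ((j, y) :: h) x) := by
        intro y
        have c := hcW ((j, y) :: h)
        rw [← intervalIntegral.integral_const_mul, ← intervalIntegral.integral_neg]
        refine intervalIntegral.integral_mono_on zero_le_one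
          (Continuous.intervalIntegrable (by fun_prop) _ _)
          (Continuous.intervalIntegrable (by fun_prop) _ _) fun x hx => ?_
        have hu : ∀ k, Function.update t j x k ∈ Set.Icc (0 : ℝ) 1 := by
          intro k
          by_cases hk : k = j
          · subst hk; simpa using hx
          · simpa [hk] using ht k
        have hb1 := neg_mul_max_le_tupleExcess σ ha hab hb j (lam := lam) hu r ((j, y) :: h)
        rw [Function.update_self] at hb1
        have hrn : (r : ℝ) ≤ n := by exact_mod_cast (by omega : r ≤ n)
        have hM0 : 0 ≤ max 0 (lam - 1 + x) := le_max_left _ _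
        have hb2 : -(n * max 0 (lam - 1 + x)) ≤ W ((j, y) :: h) x := by
          refine le_trans ?_ hb1
          have := mul_le_mul_of_nonneg_right hrn hM0
          linarith
        have hw : 0 ≤ x ^ s * (1 - x) := mul_nonneg (pow_nonneg hx.1 _) (by linarith [hx.2])
        have := mul_le_mul_of_nonneg_left hb2 hw
        linarith
      have hsucc : ∀ y, -stoppingCost n lam (s + 1) ≤
          ∫ x in (0 : ℝ)..1, x ^ (s + 1) * W ((j, y) :: h) x :=
        fun y => ih ((j, y) :: h) (s + 1) (by omega)
      have hstep : stoppingCost n lam (s + 1) = stoppingCost n lam s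
          + ((∫ x in (0 : ℝ)..1, x ^ s * (1 - x - lam))
            - n * ∫ x in (0 : ℝ)..1, x ^ s * ((1 - x) * max 0 (lam - 1 + x))) := by
        rw [stoppingCost, Finset.sum_range_succ, ← stoppingCost,
          ← intervalIntegral.integral_const_mul, ← intervalIntegral.integral_sub
            (Continuous.intervalIntegrable (by fun_prop) _ _)
            (Continuous.intervalIntegrable (by fun_prop) _ _)]
        congr 1
        exact intervalIntegral.integral_congr fun x _ => by ring
      have hint : (∫ x in (0 : ℝ)..1, x ^ s * (1 - x - lam
            + (a + (b - a) * x) * W ((j, true) :: h) x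
            + (1 - (a + (b - a) * x)) * W ((j, false) :: h) x)) =
          (∫ x in (0 : ℝ)..1, x ^ s * (1 - x - lam))
          + (b * (∫ x in (0 : ℝ)..1, x ^ (s + 1) * W ((j, true) :: h) x)
          + (a * (∫ x in (0 : ℝ)..1, x ^ s * ((1 - x) * W ((j, true) :: h) x))
          + ((1 - b) * (∫ x in (0 : ℝ)..1, x ^ (s + 1) * W ((j, false) :: h) x)
          + (1 - a) * (∫ x in (0 : ℝ)..1, x ^ s * ((1 - x) * W ((j, false) :: h) x))))) := by
        simp only [← intervalIntegral.integral_const_mul]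
        rw [← intervalIntegral.integral_add, ← intervalIntegral.integral_add,
          ← intervalIntegral.integral_add, ← intervalIntegral.integral_add]
        · exact intervalIntegral.integral_congr fun x _ => by ring
        all_goals exact Continuous.intervalIntegrable (by fun_prop) _ _
      rw [hint]
      have e1 := mul_le_mul_of_nonneg_left (hsucc true) (ha.trans hab)
      have e2 := mul_le_mul_of_nonneg_left (hfail true) ha
      have e3 := mul_le_mul_of_nonneg_left (hsucc false) (sub_nonneg.2 hb)
      have e4 := mul_le_mul_of_nonneg_left (hfail false) (sub_nonneg.2 (hab.trans hb))
      linarith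
    · have hint : (∫ x in (0 : ℝ)..1, x ^ s * ((if j = i then 1 - x - lam else 0)
            + (a + (b - a) * Function.update t i x j) * W ((j, true) :: h) x
            + (1 - (a + (b - a) * Function.update t i x j)) * W ((j, false) :: h) x)) =
          (a + (b - a) * t j) * (∫ x in (0 : ℝ)..1, x ^ s * W ((j, true) :: h) x)
          + (1 - (a + (b - a) * t j)) * ∫ x in (0 : ℝ)..1, x ^ s * W ((j, false) :: h) x := by
        simp only [← intervalIntegral.integral_const_mul]
        rw [← intervalIntegral.integral_add]
        · refine intervalIntegral.integral_congr fun x _ => ?_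
          simp only [if_neg hj, Function.update_of_ne hj]
          ring
        all_goals exact Continuous.intervalIntegrable (by fun_prop) _ _
      rw [hint]
      obtain ⟨h0, h1⟩ := ht j
      have hp0 : 0 ≤ a + (b - a) * t j := add_nonneg ha (mul_nonneg (by linarith) h0)
      have hp1 : 0 ≤ 1 - (a + (b - a) * t j) := by nlinarith
      have e1 := mul_le_mul_of_nonneg_left (ih ((j, true) :: h) s (by omega)) hp0
      have e2 := mul_le_mul_of_nonneg_left (ih ((j, false) :: h) s (by omega)) hp1
      linarith

theorem integral_max_zero_le {lam : ℝ} (h0 : 0 ≤ lam) (h1 : lam ≤ 1) :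
    ∫ x in (0 : ℝ)..1, max 0 (lam - 1 + x) ≤ lam ^ 2 / 2 := by
  have hc : Continuous fun x : ℝ => max 0 (lam - 1 + x) := by fun_prop
  rw [← intervalIntegral.integral_add_adjacent_intervals
    (hc.intervalIntegrable 0 (1 - lam)) (hc.intervalIntegrable (1 - lam) 1)]
  have e1 : ∫ x in (0 : ℝ)..(1 - lam), max 0 (lam - 1 + x) = ∫ x in (0 : ℝ)..(1 - lam), (0 : ℝ) := by
    refine intervalIntegral.integral_congr fun x hx => ?_
    rw [Set.uIcc_of_le (by linarith)] at hx
    exact max_eq_left (by linarith [hx.2])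
  have e2 : ∫ x in (1 - lam)..1, max 0 (lam - 1 + x) = ∫ x in (1 - lam)..1, (lam - 1 + x) := by
    refine intervalIntegral.integral_congr fun x hx => ?_
    rw [Set.uIcc_of_le (by linarith)] at hx
    exact max_eq_right (by linarith [hx.1])
  rw [e1, e2, intervalIntegral.integral_add (by simp) (by simp), integral_id]
  simp
  nlinarith

/-- The terms of `stoppingCost` telescope, since `x ^ k * (1 - x) = x ^ k - x ^ (k + 1)`. The
probability `1 - x ^ s` of a failure is at most `1`, and at most `s * lam` whenever the gain after
the failure is positive. -/
theorem le_stoppingCost (n : ℕ) {lam : ℝ} (h0 : 0 ≤ lam) (h1 : lam ≤ 1) (s : ℕ) :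
    1 - 1 / ((s : ℝ) + 1) - lam * (harmonic s : ℝ) - n * (min 1 (s * lam) * (lam ^ 2 / 2))
      ≤ stoppingCost n lam s := by
  have hsum : stoppingCost n lam s =
      (1 - 1 / ((s : ℝ) + 1) - lam * (harmonic s : ℝ))
        - n * ∫ x in (0 : ℝ)..1, (1 - x ^ s) * max 0 (lam - 1 + x) := by
    induction s with
    | zero => simp [stoppingCost]
    | succ s ih =>
      rw [stoppingCost, Finset.sum_range_succ, ← stoppingCost, ih, harmonic_succ]
      have hs : (∫ x in (0 : ℝ)..1,
            x ^ s * ((1 - x - lam) - n * ((1 - x) * max 0 (lam - 1 + x)))) =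
          (1 - lam) * (∫ x in (0 : ℝ)..1, x ^ s) - (∫ x in (0 : ℝ)..1, x ^ (s + 1))
          - n * ((∫ x in (0 : ℝ)..1, (1 - x ^ (s + 1)) * max 0 (lam - 1 + x))
            - ∫ x in (0 : ℝ)..1, (1 - x ^ s) * max 0 (lam - 1 + x)) := by
        rw [← intervalIntegral.integral_sub (Continuous.intervalIntegrable (by fun_prop) _ _)
            (Continuous.intervalIntegrable (by fun_prop) _ _),
          ← intervalIntegral.integral_const_mul, ← intervalIntegral.integral_const_mul,
          ← intervalIntegral.integral_sub (Continuous.intervalIntegrable (by fun_prop) _ _)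
            (Continuous.intervalIntegrable (by fun_prop) _ _),
          ← intervalIntegral.integral_sub (Continuous.intervalIntegrable (by fun_prop) _ _)
            (Continuous.intervalIntegrable (by fun_prop) _ _)]
        exact intervalIntegral.integral_congr fun x _ => by ring
      rw [hs, integral_pow, integral_pow]
      push_cast
      have h1 : (s : ℝ) + 1 ≠ 0 := by positivity
      have h2 : (s : ℝ) + 1 + 1 ≠ 0 := by positivity
      field_simp
      simp
      ring
  rw [hsum]
  have hle : ∫ x in (0 : ℝ)..1, (1 - x ^ s) * max 0 (lam - 1 + x) ≤
      min 1 (s * lam) * (lam ^ 2 / 2) := by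
    have hc : 0 ≤ min 1 (s * lam) := by positivity
    refine le_trans ?_ (mul_le_mul_of_nonneg_left (integral_max_zero_le h0 h1) hc)
    rw [← intervalIntegral.integral_const_mul]
    refine intervalIntegral.integral_mono_on zero_le_one
      (Continuous.intervalIntegrable (by fun_prop) _ _)
      (Continuous.intervalIntegrable (by fun_prop) _ _) fun x hx => ?_
    rcases le_total (lam - 1 + x) 0 with h | h
    · simp [max_eq_left h]
    · refine mul_le_mul_of_nonneg_right (le_min ?_ ?_) (le_max_left _ _)
      · linarith [pow_nonneg hx.1 s]
      · have hB := one_add_mul_le_pow (a := x - 1) (by linarith [hx.1]) s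
        rw [add_sub_cancel] at hB
        have hsl := mul_le_mul_of_nonneg_left (show 1 - x ≤ lam by linarith) s.cast_nonneg (α := ℝ)
        linarith
  have := mul_le_mul_of_nonneg_left hle (Nat.cast_nonneg (α := ℝ) n)
  linarith

/-- With a charge slightly below `√(2 / n)`, no stopping rule for a single tuple gains: the cost of
the first failure, which is asymptotically `1`, exceeds the gain `n * lam ^ 2 / 2 < 1` after it. -/
theorem exists_forall_stoppingCost_nonneg {ε : ℝ} (hε : 0 < ε) (hε1 : ε < 1) :
    ∃ n₀ : ℕ, ∀ n : ℕ, n₀ ≤ n → ∀ s ≤ n,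
      0 ≤ stoppingCost n ((1 - ε) * √(2 / (n : ℝ))) s := by
  -- The lower bound `le_stoppingCost` is used with `n * lam ^ 2 / 2 = 1 - δ`.
  set δ : ℝ := 1 - (1 - ε) ^ 2 with hδ
  have hδ0 : 0 < δ := by nlinarith
  have hδ1 : δ ≤ 1 := by nlinarith [sq_nonneg (1 - ε)]
  have hlim : Filter.Tendsto (fun n : ℕ => √(2 / (n : ℝ)) * (1 + Real.log n))
      Filter.atTop (nhds 0) := by
    have hs : Filter.Tendsto (fun x : ℝ => √2 * (1 / x ^ (1 / 2 : ℝ) + Real.log x / x ^ (1 / 2 : ℝ)))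
        Filter.atTop (nhds (√2 * (0 + 0))) := by
      refine Filter.Tendsto.const_mul _ (Filter.Tendsto.add ?_ ?_)
      · simp only [one_div]
        exact (tendsto_rpow_atTop (show (0 : ℝ) < 2⁻¹ by norm_num)).inv_tendsto_atTop
      · exact (isLittleO_log_rpow_atTop (show (0 : ℝ) < 1 / 2 by norm_num)).tendsto_div_nhds_zero
    simp only [add_zero, mul_zero] at hs
    refine (hs.comp tendsto_natCast_atTop_atTop).congr fun n => ?_
    simp only [Function.comp]
    rw [← Real.sqrt_eq_rpow, Real.sqrt_div zero_le_two]
    ring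
  obtain ⟨N, hN⟩ := Filter.eventually_atTop.1
    (hlim.eventually (gt_mem_nhds (show (0 : ℝ) < δ / 8 by positivity)))
  refine ⟨max N 1, fun n hn s hs => ?_⟩
  have hn1 : (1 : ℝ) ≤ n := by exact_mod_cast (le_max_right _ _).trans hn
  have hNn := hN n ((le_max_left _ _).trans hn)
  have hlog : 0 ≤ Real.log n := Real.log_nonneg hn1
  set q := √(2 / (n : ℝ)) with hq
  have hq0 : 0 ≤ q := Real.sqrt_nonneg _
  have hq2 : n * q ^ 2 = 2 := by
    rw [hq, Real.sq_sqrt (by positivity)]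
    field_simp
  have hqlog : 0 ≤ q * Real.log n := mul_nonneg hq0 hlog
  set lam := (1 - ε) * q with hlam
  have hl0 : 0 ≤ lam := mul_nonneg (by linarith) hq0
  have hlq : lam ≤ q := by nlinarith
  have hgain : n * (lam ^ 2 / 2) = 1 - δ := by
    rw [hlam, mul_pow, hδ]
    linear_combination (1 - ε) ^ 2 / 2 * hq2
  refine le_trans ?_ (le_stoppingCost n hl0 (by linarith) s)
  rcases Nat.eq_zero_or_pos s with rfl | hs0
  · simp
  have hs1 : (1 : ℝ) ≤ s := by exact_mod_cast hs0
  have hH : lam * (harmonic s : ℝ) ≤ δ / 8 := by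
    have hsn : Real.log s ≤ Real.log n :=
      Real.log_le_log (by linarith) (by exact_mod_cast hs)
    calc lam * (harmonic s : ℝ) ≤ lam * (1 + Real.log n) :=
          mul_le_mul_of_nonneg_left ((harmonic_le_one_add_log s).trans (by linarith)) hl0
      _ ≤ q * (1 + Real.log n) := mul_le_mul_of_nonneg_right hlq (by linarith)
      _ ≤ δ / 8 := hNn.le
  have hmin : n * (min 1 (s * lam) * (lam ^ 2 / 2)) = (1 - δ) * min 1 (s * lam) := by
    rw [← hgain]; ring
  rw [hmin]
  -- For large `s` the first failure costs nearly `1`; for small `s` the gain after it is small.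
  rcases le_total (1 / ((s : ℝ) + 1)) (δ / 2) with hbig | hsmall
  · have := mul_le_mul_of_nonneg_left (min_le_left 1 (s * lam)) (sub_nonneg.2 hδ1)
    linarith
  · have hpos : 0 < (s : ℝ) + 1 := by positivity
    have hsδ : δ * (s + 1) ≤ 2 := by
      rw [le_div_iff₀ hpos] at hsmall
      linarith
    have hsl : s * lam ≤ 1 / 4 := by
      have : s * lam ≤ s * (δ / 8) := mul_le_mul_of_nonneg_left (by linarith) (by linarith)
      linarith
    have hhalf : 1 / ((s : ℝ) + 1) ≤ 1 / 2 := one_div_le_one_div_of_le two_pos (by linarith)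
    have hm0 : 0 ≤ min 1 (s * lam) := by positivity
    have hm1 : min 1 (s * lam) ≤ 1 / 4 := (min_le_right _ _).trans hsl
    have : (1 - δ) * min 1 (s * lam) ≤ 1 / 4 := by nlinarith
    linarith

/-! ### Averaging over the success probabilities -/

/-- The law of one normalized success probability: uniform on `[0, 1]`. -/
noncomputable abbrev unitLaw : Measure ℝ := volume.restrict (Set.Icc (0 : ℝ) 1)

instance isProbabilityMeasure_unitLaw : IsProbabilityMeasure unitLaw :=
  ⟨by simp [unitLaw]⟩

theorem pi_uniformLaw_eq_map {R : Type*} [Fintype R] (a b : ℝ) :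
    (Measure.pi fun _ : R => uniformLaw a b) =
      (Measure.pi fun _ : R => unitLaw).map (fun t j => a + (b - a) * t j) := by
  have hm : Measurable fun t : ℝ => a + (b - a) * t := by fun_prop
  have : IsProbabilityMeasure (unitLaw.map fun t : ℝ => a + (b - a) * t) :=
    Measure.isProbabilityMeasure_map hm.aemeasurable
  exact (Measure.pi_map_pi (μ := fun _ : R => unitLaw) (f := fun _ t => a + (b - a) * t)
    (hμ := fun _ => inferInstance) fun _ => hm.aemeasurable).symm

theorem pi_unitLaw_eq_restrict (R : Type*) [Fintype R] :
    (Measure.pi fun _ : R => unitLaw) =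
      (Measure.pi fun _ : R => (volume : Measure ℝ)).restrict
        (Set.univ.pi fun _ => Set.Icc (0 : ℝ) 1) :=
  (Measure.restrict_pi_pi _ _).symm

theorem integrable_pi_unitLaw {R : Type*} [Fintype R] {f : (R → ℝ) → ℝ} (hf : Continuous f) :
    Integrable f (Measure.pi fun _ : R => unitLaw) := by
  rw [pi_unitLaw_eq_restrict]
  exact hf.continuousOn.integrableOn_compact (isCompact_univ_pi fun _ => isCompact_Icc)

/-- Integrating over the success probability of tuple `i` first, those of the other tuples being
fixed, every tuple contributes nonnegatively. -/
theorem integral_tupleExcess_nonneg {cardR : ℕ} (σ : Strategy (Fin cardR)) {a b lam : ℝ}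
    (ha : 0 ≤ a) (hab : a ≤ b) (hb : b ≤ 1) (i : Fin cardR) {n m : ℕ} (hmn : m ≤ n)
    (hA : ∀ s ≤ n, 0 ≤ stoppingCost n lam s) :
    0 ≤ ∫ t, tupleExcess σ a b lam i m [] t ∂(Measure.pi fun _ : Fin cardR => unitLaw) := by
  obtain ⟨k, rfl⟩ : ∃ k, cardR = k + 1 := ⟨cardR - 1, by have := i.2; omega⟩
  have hcont := continuous_tupleExcess σ a b lam i m []
  have hmp := (measurePreserving_piFinSuccAbove (fun _ : Fin (k + 1) => unitLaw) i).symm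
  have hint := (hmp.integrable_comp_emb (MeasurableEquiv.measurableEmbedding _)).2
    (integrable_pi_unitLaw hcont)
  rw [← hmp.integral_comp (MeasurableEquiv.measurableEmbedding _)]
  refine le_of_le_of_eq ?_ (integral_prod_symm _ hint).symm
  refine integral_nonneg_of_ae ?_
  have hcube : ∀ᵐ y ∂(Measure.pi fun _ : Fin k => unitLaw), ∀ j, y j ∈ Set.Icc (0 : ℝ) 1 := by
    rw [pi_unitLaw_eq_restrict]
    filter_upwards [ae_restrict_mem (MeasurableSet.univ_pi fun _ => measurableSet_Icc)]
      with y hy j using hy j (Set.mem_univ j)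
  filter_upwards [hcube] with y hy
  have hy' : ∀ j, i.insertNth (α := fun _ => ℝ) 0 y j ∈ Set.Icc (0 : ℝ) 1 := by
    intro j
    rcases Fin.eq_self_or_eq_succAbove i j with rfl | ⟨j, rfl⟩
    · simp
    · simpa using hy j
  have h0 := neg_stoppingCost_le_integral σ ha hab hb i hy' hA m [] 0 (by omega)
  simp only [stoppingCost, Finset.range_zero, Finset.sum_empty, neg_zero, pow_zero, one_mul,
    Fin.update_insertNth] at h0
  rw [intervalIntegral.integral_of_le zero_le_one, ← integral_Icc_eq_integral_Ioc] at h0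
  exact h0

/-- If no stopping rule for a single tuple profits from the charge `lam`, the normalized expected
failure proportion is at least `lam`. -/
theorem charge_le_expectedFailureProportion {cardR : ℕ} (σ : Strategy (Fin cardR)) {a b lam : ℝ}
    (ha : 0 ≤ a) (hab : a ≤ b) (hb : b ≤ 1) {n m : ℕ} (hm : 1 ≤ m) (hmn : m ≤ n)
    (hA : ∀ s ≤ n, 0 ≤ stoppingCost n lam s) :
    (1 - b) + (b - a) * lam ≤ expectedFailureProportion σ m a b := by
  have hm0 : (0 : ℝ) < m := by exact_mod_cast hm
  have hgiven : ∀ t : Fin cardR → ℝ,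
      expectedFailureProportionGiven σ m (fun j => a + (b - a) * t j) =
        ((1 - b) + (b - a) * lam) + (b - a) / m * ∑ i, tupleExcess σ a b lam i m [] t := by
    intro t
    have h := sum_historyProb_mul_eq_iterate σ (fun j => a + (b - a) * t j) m
      (fun h => ((h.map Prod.snd).count false : ℝ))
    rw [iterate_stepExpectation_count σ a b lam t m []] at h
    simp only [expectedFailureProportionGiven, failureProportion, List.length_ofFn, ← mul_div_assoc]
    rw [← Finset.sum_div, h]
    simp
    field_simp
  have hcg : Continuous fun p => expectedFailureProportionGiven σ m p := by
    simp only [expectedFailureProportionGiven]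
    refine continuous_finsetSum _ fun h _ => Continuous.mul_const ?_ _
    generalize List.ofFn h = l
    induction l with
    | nil => exact continuous_const
    | cons x l ih =>
      simp only [historyProb]
      split_ifs <;> fun_prop
  have hmeas : Measurable fun (t : Fin cardR → ℝ) j => a + (b - a) * t j := by fun_prop
  rw [expectedFailureProportion, pi_uniformLaw_eq_map,
    integral_map hmeas.aemeasurable hcg.aestronglyMeasurable]
  simp only [hgiven]
  have hi : ∀ i : Fin cardR, Integrable (fun t => tupleExcess σ a b lam i m [] t)
      (Measure.pi fun _ : Fin cardR => unitLaw) :=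
    fun i => integrable_pi_unitLaw (continuous_tupleExcess σ a b lam i m [])
  rw [integral_add (integrable_const _) ((integrable_finsetSum _ fun i _ => hi i).const_mul _),
    integral_const_mul, integral_finsetSum _ fun i _ => hi i]
  have hnn := Finset.sum_nonneg fun i (_ : i ∈ Finset.univ) =>
    integral_tupleExcess_nonneg σ ha hab hb i hmn hA
  have : 0 ≤ (b - a) / m := div_nonneg (by linarith) hm0.le
  have := mul_nonneg this hnn
  simp
  linarith

theorem mainTheorem1 (ε : ℝ) (hε : 0 < ε) :
    ∃ n₀ : ℕ, ∀ cardS : ℕ, n₀ ≤ cardS →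
      ∀ a b : ℝ, 0 ≤ a → a ≤ b → b ≤ 1 →
        ∀ (cardR : ℕ) (σ : Strategy (Fin cardR)) (m : ℕ), 1 ≤ m → m ≤ cardS →
          (1 - b) + (1 - ε) * ((b - a) * √(2 / (cardS : ℝ)))
            ≤ expectedFailureProportion σ m a b := by
  obtain ⟨n₀, h⟩ := exists_forall_stoppingCost_nonneg (ε := min ε (1 / 2))
    (lt_min hε (by norm_num)) ((min_le_right _ _).trans_lt (by norm_num))
  refine ⟨n₀, fun cardS hS a b ha hab hb cardR σ m hm hmS => ?_⟩
  refine le_trans ?_ (charge_le_expectedFailureProportion σ ha hab hb hm hmS (h cardS hS))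
  have h0 : 0 ≤ (b - a) * √(2 / (cardS : ℝ)) :=
    mul_nonneg (by linarith) (Real.sqrt_nonneg _)
  have := mul_le_mul_of_nonneg_right (sub_le_sub_left (min_le_left ε (1 / 2)) 1) h0
  linarith
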